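/- **Setting.** Let $\mathcal C$ be a locally finitely presentable category. A *directed set* is a non-empty poset in which any two elements have an upper bound; a poset is *terminating* if it has no infinite strictly decreasing sequence. For a directed set $I$, an *$I$-filtration* of an object $E$ is a functor $E_\bullet : I\to\mathcal C$ with a natural transformation $\iota_\bullet: E_\bullet\Rightarrow E$ exhibiting $E$ as its colimit. Write $E_{\min}$ for the colimit of $E_\bullet$ over the minimal elements of $I$, with canonical map $\iota_{\min}:E_{\min}\to E$; write $E_{<i}=\operatorname{colim}_{k<i}E_k$ if $i$ is not minimal and $E_{<i}=E_i$ if $i$ is minimal, with canonical map $\iota_{<i}:E_{<i}\to E$. This gives a functor $E_{<\bullet}:I\to\mathcal C$. A *graph over $E$* is an object $R$ with maps $s_R,t_R:R\to E$; morphisms of graphs commute with sources and targets. $E$ is a graph with $s=t=\mathrm{id}$; $RS$ is the pullback of $t_R$ and $s_S$; $R+S$ is the coproduct, and $u : E\to R+E$ is the coprojection; $R^\circ$ is $R$ with source and target exchanged; $R^+=\coprod_{n\ge1}R^{\times_E n}$, $R^*=R^++E$ and $R^{\mathrm{sym}}=(R+R^\circ)^*$, and $u: E\to R^{\mathrm{sym}}$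 also denotes the coprojection; $E/R$ is the coequalizer of $s_R,t_R$. A *terminating graph* $(R,h,h^\tau)$ over an $I$-filtered object $E$ is a graph $R$ over $E$, a map $h:E\to R+E$ and a natural transformation $h^\tau_\bullet:E_\bullet\Rightarrow E_{<\bullet}$ such that $I$ is terminating, $s_{R+E}\circ h=\mathrm{id}_E$, $t_{R+E}\circ h\circ\iota_i=\iota_{<i}\circ h^\tau_i$ for all $i$, and, for $i$ minimal, $h\circ\iota_i=u\circ\iota_i$ and $h^\tau_i=\mathrm{id}_{E_i}$. A *local-confluence structure* on it is a $J$-filtration $R_\bullet$ of the object $R$, where $J$ is a non-empty terminating totally ordered set and $R_{\min}$ is an initial object, together with a natural transformation $c_\bullet: R_\bullet\Rightarrow (R_{<\bullet})^{\mathrm{sym}}$ such that for all $j$, with $\iota^{\mathrm{sym}}_{<j}:(R_{<j})^{\mathrm{sym}}\to R^{\mathrm{sym}}$ the canonical map and $\iota_j:R_j\to R$, $$s_{R^{\mathrm{sym}}}\circ\iota^{\mathrm{sym}}_{<j}\circ c_j=t_{R+E}\circ h\circ s_R\circ\iota_j,\qquad t_{R^{\mathrm{sym}}}\circ\iota^{\mathrm{sym}}_{<j}\circ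 c_j=t_R\circ\iota_j .$$ A *strategy* for a graph $S$ over $E$ is a pair $H:E\to S$, $H^\tau:E\to E_{\min}$ with $s_S\circ H=\mathrm{id}_E$, $t_S\circ H=\iota_{\min}\circ H^\tau$, $H^\tau\circ\iota_{\min}=\mathrm{id}$. It is *confluent* if $H^\tau\circ s_S=H^\tau\circ t_S$. A *composition* is a morphism of graphs $\mu:(R+E)R^{\mathrm{sym}}\to R^{\mathrm{sym}}$ with $\mu\circ\langle u\circ s_{R^{\mathrm{sym}}},\mathrm{id}\rangle=\mathrm{id}_{R^{\mathrm{sym}}}$ (for sets: prefixing a path by a possibly trivial step). A strategy $(H,H^\tau)$ for $R^{\mathrm{sym}}$ is *induced* by $(R,h,h^\tau)$ via $\mu$ if $H=\mu\circ\langle h,H\circ t_{R+E}\circ h\rangle$, $H^\tau=H^\tau\circ t_{R+E}\circ h$, and $H\circ\iota_i=u\circ\iota_i$ for all minimal $i$. **Theorem (Newman's Lemma for graphs).** Let $(R,h,h^\tau)$ be a terminating graph over a filtered object $E$ of $\mathcal C$, equipped with a local-confluence structure. Then: 1. There is a unique $N:E\to E_{\min}$ with $N\circ\iota_{\min}=\mathrm{id}$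 and $N=N\circ t_{R+E}\circ h$, and $N\circ s_{R^{\mathrm{sym}}}=N\circ t_{R^{\mathrm{sym}}}$. 2. For every composition $\mu$ there is a unique strategy for $R^{\mathrm{sym}}$ induced by $(R,h,h^\tau)$ via $\mu$; its second component is $N$, and it is confluent. Moreover every strategy for $R^{\mathrm{sym}}$ has second component $N$ and is confluent. 3. There are isomorphisms $E/R\cong E/R^{\mathrm{sym}}\cong E_{\min}$, compatible with the quotient maps from $E$ and with $N$; the second is inverse to the composite $E_{\min}\xrightarrow{\iota_{\min}}E\to E/R^{\mathrm{sym}}$. -/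

import Mathlib

open CategoryTheory CategoryTheory.Limits

universe w v u

namespace GraphRewriting

/-! ### Locally finitely presentable categories have pullbacks -/

theorem hasLimits_aux (κ : Cardinal.{w}) [Fact κ.IsRegular] (C : Type u) [Category.{w} C]
    [IsCardinalLocallyPresentable.{w} C κ] : HasLimitsOfSize.{w, w} C := by
  let P := isCardinalPresentable C κ
  let e := equivSmallModel.{w} P.FullSubcategory
  let A : SmallModel.{w} P.FullSubcategory ⥤ C := e.inverse ⋙ P.ι
  have : A.IsDense := inferInstance
  let G : C ⥤ (SmallModel.{w} P.FullSubcategory)ᵒᵖ ⥤ Type w :=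
    Presheaf.restrictedULiftYoneda.{w} A
  have : G.Full := inferInstanceAs (Presheaf.restrictedULiftYoneda.{w} A).Full
  have : G.Faithful := inferInstanceAs (Presheaf.restrictedULiftYoneda.{w} A).Faithful
  let adj := Presheaf.uliftYonedaAdjunction.{w} _ (uliftYoneda.{w}.leftKanExtensionUnit A)
  have : Reflective G := { L := _, adj := adj }
  exact hasLimits_of_reflective G

instance hasPullbacks_of_isLocallyFinitelyPresentable (C : Type u) [Category.{v} C]
    [IsLocallyFinitelyPresentable.{w} C] : HasPullbacks C := by
  have : Fact (Cardinal.IsRegular Cardinal.aleph0.{w}) := Cardinal.fact_isRegular_aleph0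
  have e := ShrinkHoms.equivalence.{w} C
  have : IsCardinalLocallyPresentable.{w} (ShrinkHoms.{u} C) Cardinal.aleph0.{w} :=
    e.isCardinalLocallyPresentable _
  have : HasLimitsOfSize.{w, w} (ShrinkHoms.{u} C) := hasLimits_aux Cardinal.aleph0.{w} _
  have : HasLimitsOfSize.{w, w} C := Adjunction.has_limits_of_equivalence e.functor
  have : HasLimitsOfSize.{0, 0} C := hasLimitsOfSizeShrink.{0, 0, w, w} C
  infer_instance

/-! ### Graphs over an object -/

variable {C : Type u} [Category.{v} C]

/-- A graph over `E`: an object with a source map and a target map to `E`. -/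
structure GraphOver (E : C) where
  obj : C
  src : obj ⟶ E
  tgt : obj ⟶ E

namespace GraphOver

variable {E : C}

/-- A morphism of graphs over `E`. -/
@[ext]
structure Hom (R S : GraphOver E) where
  hom : R.obj ⟶ S.obj
  w_src : hom ≫ S.src = R.src
  w_tgt : hom ≫ S.tgt = R.tgt

instance instCategory : Category (GraphOver E) where
  Hom := Hom
  id R := ⟨𝟙 R.obj, Category.id_comp _, Category.id_comp _⟩
  comp f g := ⟨f.hom ≫ g.hom, by rw [Category.assoc, g.w_src, f.w_src],
    by rw [Category.assoc, g.w_tgt, f.w_tgt]⟩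
  id_comp f := Hom.ext (Category.id_comp _)
  comp_id f := Hom.ext (Category.comp_id _)
  assoc f g h := Hom.ext (Category.assoc _ _ _)

/-- The morphism of graphs given by a compatible morphism of `C`. -/
def homMk {R S : GraphOver E} (f : R.obj ⟶ S.obj) (hs : f ≫ S.src = R.src)
    (ht : f ≫ S.tgt = R.tgt) : R ⟶ S :=
  Hom.mk f hs ht

/-- The underlying object functor. -/
def forget (E : C) : GraphOver E ⥤ C where
  obj R := R.obj
  map f := f.hom
  map_id _ := rfl
  map_comp _ _ := rfl

@[ext]
theorem hom_ext {R S : GraphOver E} {f g : R ⟶ S} (h : f.hom = g.hom) : f = g :=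
  Hom.ext h

@[simp] theorem id_hom (R : GraphOver E) : Hom.hom (𝟙 R) = 𝟙 R.obj := rfl

@[simp] theorem comp_hom {R S T : GraphOver E} (f : R ⟶ S) (g : S ⟶ T) :
    (f ≫ g).hom = f.hom ≫ g.hom := rfl

@[simp] theorem hom_src {R S : GraphOver E} (f : R ⟶ S) : f.hom ≫ S.src = R.src := f.w_src

@[simp] theorem hom_tgt {R S : GraphOver E} (f : R ⟶ S) : f.hom ≫ S.tgt = R.tgt := f.w_tgt

/-- `E` itself, as a graph over `E`. -/
abbrev unit (E : C) : GraphOver E := ⟨E, 𝟙 E, 𝟙 E⟩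

/-- The opposite graph `R°`. -/
abbrev opp (R : GraphOver E) : GraphOver E := ⟨R.obj, R.tgt, R.src⟩

/-- The action of `R ↦ R°` on morphisms. -/
def oppMap {R S : GraphOver E} (f : R ⟶ S) : opp R ⟶ opp S :=
  homMk f.hom f.w_tgt f.w_src

section Prod

variable [HasPullbacks C]

/-- The product `RS` : composable pairs, that is the pullback of `R.tgt` and `S.src`. -/
noncomputable abbrev prod (R S : GraphOver E) : GraphOver E where
  obj := pullback R.tgt S.src
  src := pullback.fst R.tgt S.src ≫ R.src
  tgt := pullback.snd R.tgt S.src ≫ S.tgt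

/-- The morphism `⟨a, b⟩ : X ⟶ RS` defined by `a : X ⟶ R`, `b : X ⟶ S` with
`R.tgt ∘ a = S.src ∘ b`. -/
noncomputable def pair {R S : GraphOver E} {X : C} (a : X ⟶ R.obj) (b : X ⟶ S.obj)
    (h : a ≫ R.tgt = b ≫ S.src) : X ⟶ (prod R S).obj :=
  pullback.lift a b h

/-- The action of the product on morphisms. -/
noncomputable def prodMap {R R' S S' : GraphOver E} (f : R ⟶ R') (g : S ⟶ S') :
    prod R S ⟶ prod R' S' :=
  homMk
    (pullback.lift (pullback.fst R.tgt S.src ≫ f.hom) (pullback.snd R.tgt S.src ≫ g.hom)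
      (by simp [pullback.condition]))
    ((pullback.lift_fst_assoc _ _ _ _).trans
      ((Category.assoc _ _ _).trans (congrArg _ f.w_src)))
    ((pullback.lift_snd_assoc _ _ _ _).trans
      ((Category.assoc _ _ _).trans (congrArg _ g.w_tgt)))

theorem prodMap_fst {R R' S S' : GraphOver E} (f : R ⟶ R') (g : S ⟶ S') :
    (prodMap f g).hom ≫ pullback.fst R'.tgt S'.src = pullback.fst R.tgt S.src ≫ f.hom :=
  pullback.lift_fst _ _ _

theorem prodMap_snd {R R' S S' : GraphOver E} (f : R ⟶ R') (g : S ⟶ S') :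
    (prodMap f g).hom ≫ pullback.snd R'.tgt S'.src = pullback.snd R.tgt S.src ≫ g.hom :=
  pullback.lift_snd _ _ _

/-- `iter R n` is the iterated product `R ×_E ⋯ ×_E R` with `n + 1` factors. -/
noncomputable def iter (R : GraphOver E) : ℕ → GraphOver E
  | 0 => R
  | n + 1 => prod R (iter R n)

/-- The action of `R ↦ iter R n` on morphisms. -/
noncomputable def iterMap {R S : GraphOver E} (f : R ⟶ S) : ∀ n, iter R n ⟶ iter S n
  | 0 => f
  | n + 1 => prodMap f (iterMap f n)

theorem prodMap_id (R S : GraphOver E) : prodMap (𝟙 R) (𝟙 S) = 𝟙 (prod R S) := by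
  apply hom_ext
  apply pullback.hom_ext <;> simp [prodMap, homMk]

theorem prodMap_comp {R R' R'' S S' S'' : GraphOver E} (f : R ⟶ R') (f' : R' ⟶ R'')
    (g : S ⟶ S') (g' : S' ⟶ S'') :
    prodMap (f ≫ f') (g ≫ g') = prodMap f g ≫ prodMap f' g' := by
  apply hom_ext
  apply pullback.hom_ext
  · rw [prodMap_fst, comp_hom, comp_hom, Category.assoc, prodMap_fst, ← Category.assoc]
    exact (congrArg (· ≫ f'.hom) (prodMap_fst f g)).symm.trans (Category.assoc _ _ _)
  · rw [prodMap_snd, comp_hom, comp_hom, Category.assoc, prodMap_snd, ← Category.assoc]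
    exact (congrArg (· ≫ g'.hom) (prodMap_snd f g)).symm.trans (Category.assoc _ _ _)

theorem iterMap_id (R : GraphOver E) (n : ℕ) : iterMap (𝟙 R) n = 𝟙 (iter R n) := by
  induction n with
  | zero => rfl
  | succ n ih => simp only [iterMap, ih, prodMap_id]; rfl

theorem iterMap_comp {R S T : GraphOver E} (f : R ⟶ S) (g : S ⟶ T) (n : ℕ) :
    iterMap (f ≫ g) n = iterMap f n ≫ iterMap g n := by
  induction n with
  | zero => rfl
  | succ n ih => simp only [iterMap, ih, prodMap_comp]; rfl

end Prod

section Sum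

variable [HasCountableCoproducts C]

/-- The sum `R + S`. -/
noncomputable abbrev sum (R S : GraphOver E) : GraphOver E where
  obj := R.obj ⨿ S.obj
  src := coprod.desc R.src S.src
  tgt := coprod.desc R.tgt S.tgt

/-- The action of the sum on morphisms. -/
noncomputable def sumMap {R R' S S' : GraphOver E} (f : R ⟶ R') (g : S ⟶ S') :
    sum R S ⟶ sum R' S' :=
  homMk (coprod.map f.hom g.hom) (by simp) (by simp)

theorem sumMap_id (R S : GraphOver E) : sumMap (𝟙 R) (𝟙 S) = 𝟙 (sum R S) := by
  apply hom_ext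
  apply coprod.hom_ext <;> simp [sumMap, homMk]

theorem sumMap_comp {R R' R'' S S' S'' : GraphOver E} (f : R ⟶ R') (f' : R' ⟶ R'')
    (g : S ⟶ S') (g' : S' ⟶ S'') :
    sumMap (f ≫ f') (g ≫ g') = sumMap f g ≫ sumMap f' g' := by
  apply hom_ext
  apply coprod.hom_ext <;> simp [sumMap, homMk]

/-- The unit `u : E ⟶ R + E`. -/
noncomputable def sumUnit (R : GraphOver E) : E ⟶ (sum R (unit E)).obj :=
  (coprod.inr : E ⟶ R.obj ⨿ E)

theorem sumUnit_tgt (R : GraphOver E) : sumUnit R ≫ (sum R (unit E)).tgt = 𝟙 E :=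
  coprod.inr_desc _ _

end Sum

section Closure

variable [HasPullbacks C] [HasCountableCoproducts C]

/-- The transitive closure `R⁺`, the coproduct of all `R ×_E ⋯ ×_E R` with at least
one factor. -/
noncomputable abbrev plus (R : GraphOver E) : GraphOver E where
  obj := ∐ fun n : ℕ => (iter R n).obj
  src := Limits.Sigma.desc fun n => (iter R n).src
  tgt := Limits.Sigma.desc fun n => (iter R n).tgt

/-- The action of `R ↦ R⁺` on morphisms. -/
noncomputable def plusMap {R S : GraphOver E} (f : R ⟶ S) : plus R ⟶ plus S :=
  homMk (Limits.Sigma.map fun n => (iterMap f n).hom)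
    (by apply Limits.Sigma.hom_ext; intro n; simp)
    (by apply Limits.Sigma.hom_ext; intro n; simp)

/-- The transitive reflexive closure `R* = R⁺ + E`. -/
noncomputable abbrev star (R : GraphOver E) : GraphOver E := sum (plus R) (unit E)

/-- The reflexive symmetric transitive closure `(R + R°)*`. -/
noncomputable abbrev sym (R : GraphOver E) : GraphOver E := star (sum R (opp R))

/-- The unit `u : E ⟶ (R + R°)*`. -/
noncomputable def symUnit (R : GraphOver E) : E ⟶ (sym R).obj :=
  sumUnit (plus (sum R (opp R)))

theorem symUnit_src (R : GraphOver E) : symUnit R ≫ (sym R).src = 𝟙 E :=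
  coprod.inr_desc _ _

theorem plusMap_id (R : GraphOver E) : plusMap (𝟙 R) = 𝟙 (plus R) := by
  apply hom_ext
  apply Limits.Sigma.hom_ext; intro n; simp [plusMap, homMk, iterMap_id]

theorem plusMap_comp {R S T : GraphOver E} (f : R ⟶ S) (g : S ⟶ T) :
    plusMap (f ≫ g) = plusMap f ≫ plusMap g := by
  apply hom_ext
  apply Limits.Sigma.hom_ext; intro n; simp [plusMap, homMk, iterMap_comp]

/-- The functor `R ↦ (R + R°)*` on graphs over `E`. -/
noncomputable def symFunctor (E : C) : GraphOver E ⥤ GraphOver E where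
  obj R := sym R
  map f := sumMap (plusMap (sumMap f (oppMap f))) (𝟙 (unit E))
  map_id R := by
    have h : oppMap (𝟙 R) = 𝟙 (opp R) := rfl
    rw [h, sumMap_id, plusMap_id, sumMap_id]
  map_comp f g := by
    have h : oppMap (f ≫ g) = oppMap f ≫ oppMap g := rfl
    rw [h, sumMap_comp, plusMap_comp, ← sumMap_comp, Category.id_comp]

end Closure

end GraphOver

/-! ### Filtered objects -/

/-- An `I`-filtration of `E`: a functor `I ⥤ C` together with a cocone exhibiting `E` as its
colimit. -/
structure Filtration (I : Type w) [PartialOrder I] (E : C) where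
  obj : I ⥤ C
  ι : obj ⟶ (Functor.const I).obj E
  isColimit : IsColimit (Cocone.mk E ι)

namespace Filtration

variable {I : Type w} [PartialOrder I] {E : C}

/-- The inclusion of a subset of a partially ordered set, as a functor. -/
abbrev incl (S : Set I) : S ⥤ I where
  obj k := k.1
  map f := homOfLE (leOfHom f)

/-- The elements over which the colimit `E_{<i}` is taken: all `k < i` if `i` is not minimal;
only `i` itself if `i` is minimal, so that then `E_{<i}` is `E_i`. -/
def below (i : I) : Set I := {k | k < i ∨ (k = i ∧ IsMin i)}

theorem below_subset {i j : I} (h : i ≤ j) : below i ⊆ below j := by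
  rintro k (hk | ⟨rfl, hk⟩)
  · exact Or.inl (hk.trans_le h)
  · rcases h.lt_or_eq with h' | rfl
    · exact Or.inl h'
    · exact Or.inr ⟨rfl, hk⟩

/-- The set of minimal elements. -/
abbrev minimals (I : Type w) [PartialOrder I] : Set I := {i | IsMin i}

/-- The canonical morphism `ι_i : E_i ⟶ E`. -/
def inj (F : Filtration I E) (i : I) : F.obj.obj i ⟶ E := F.ι.app i

theorem map_ι (F : Filtration I E) {k l : I} (h : k ≤ l) :
    F.obj.map (homOfLE h) ≫ F.inj l = F.inj k :=
  (F.ι.naturality (homOfLE h)).trans (Category.comp_id _)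

variable [HasColimitsOfSize.{w, w} C] (F : Filtration I E)

/-- The colimit of the restriction of `E_•` to a subset of `I`. -/
noncomputable abbrev on (S : Set I) : C := colimit (incl S ⋙ F.obj)

/-- The canonical morphism from `E_k` to the colimit over `S`, for `k ∈ S`. -/
noncomputable def toOn (S : Set I) (k : I) (hk : k ∈ S) : F.obj.obj k ⟶ F.on S :=
  colimit.ι (incl S ⋙ F.obj) ⟨k, hk⟩

/-- The morphism from the colimit over `S` induced by a compatible family. -/
noncomputable def onDesc (S : Set I) {X : C} (f : ∀ k, k ∈ S → (F.obj.obj k ⟶ X))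
    (hf : ∀ (k l : I) (hk : k ∈ S) (hl : l ∈ S) (h : k ≤ l),
      F.obj.map (homOfLE h) ≫ f l hl = f k hk) : F.on S ⟶ X :=
  colimit.desc (incl S ⋙ F.obj)
    { pt := X
      ι :=
        { app := fun k => f k.1 k.2
          naturality := fun k l g => (hf k.1 l.1 k.2 l.2 (leOfHom g)).trans
            (Category.comp_id _).symm } }

theorem toOn_onDesc (S : Set I) {X : C} (f : ∀ k, k ∈ S → (F.obj.obj k ⟶ X))
    (hf : ∀ (k l : I) (hk : k ∈ S) (hl : l ∈ S) (h : k ≤ l),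
      F.obj.map (homOfLE h) ≫ f l hl = f k hk) (k : I) (hk : k ∈ S) :
    F.toOn S k hk ≫ F.onDesc S f hf = f k hk :=
  colimit.ι_desc _ _

theorem on_hom_ext {S : Set I} {X : C} {f g : F.on S ⟶ X}
    (h : ∀ k hk, F.toOn S k hk ≫ f = F.toOn S k hk ≫ g) : f = g :=
  colimit.hom_ext fun k => h k.1 k.2

theorem map_toOn (S : Set I) {k l : I} (hk : k ∈ S) (hl : l ∈ S) (h : k ≤ l) :
    F.obj.map (homOfLE h) ≫ F.toOn S l hl = F.toOn S k hk :=
  colimit.w (incl S ⋙ F.obj) (homOfLE h : (⟨k, hk⟩ : S) ⟶ ⟨l, hl⟩)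

/-- The morphism induced by an inclusion `S ⊆ T`. -/
noncomputable def onMap {S T : Set I} (h : S ⊆ T) : F.on S ⟶ F.on T :=
  F.onDesc S (fun k hk => F.toOn T k (h hk)) fun _ _ hk hl hkl => F.map_toOn T (h hk) (h hl) hkl

/-- The canonical morphism to `E` from the colimit over `S`. -/
noncomputable def onι (S : Set I) : F.on S ⟶ E :=
  F.onDesc S (fun k _ => F.inj k) fun _ _ _ _ h => F.map_ι h

/-- The functor `E_{<•} : I ⥤ C`. -/
noncomputable def lt : I ⥤ C where
  obj i := F.on (below i)
  map f := F.onMap (below_subset (leOfHom f))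
  map_id i := F.on_hom_ext fun k hk => by
    rw [onMap, toOn_onDesc, Category.comp_id]
  map_comp f g := F.on_hom_ext fun k hk => by
    rw [onMap, onMap, onMap, toOn_onDesc, ← Category.assoc, toOn_onDesc, toOn_onDesc]

/-- The canonical morphism `ι_{<i} : E_{<i} ⟶ E`. -/
noncomputable def ltι (i : I) : F.lt.obj i ⟶ E := F.onι (below i)

theorem lt_map_ltι {i j : I} (f : i ⟶ j) : F.lt.map f ≫ F.ltι j = F.ltι i :=
  F.on_hom_ext fun k hk => by
    change F.toOn _ k hk ≫ F.onMap _ ≫ F.onι _ = F.toOn _ k hk ≫ F.onι _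
    rw [onMap, onι, onι, ← Category.assoc, toOn_onDesc, toOn_onDesc, toOn_onDesc]

/-- For `i` minimal, the canonical identification `E_i ⟶ E_{<i}`. -/
noncomputable def toLtOfIsMin (i : I) (hi : IsMin i) : F.obj.obj i ⟶ F.lt.obj i :=
  F.toOn (below i) i (Or.inr ⟨rfl, hi⟩)

/-- The object of normal forms: the colimit over the minimal elements of `I`. -/
noncomputable abbrev min : C := F.on (minimals I)

/-- The canonical morphism from the object of normal forms to `E`. -/
noncomputable def minι : F.min ⟶ E := F.onι (minimals I)

/-- If `E` underlies a graph `R` over `E'`, this is `R_{<•}` as a functor to graphs over `E'`. -/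
noncomputable def ltGraph {E' : C} {R : GraphOver E'} (G : Filtration I R.obj) :
    I ⥤ GraphOver E' where
  obj i := ⟨G.lt.obj i, G.ltι i ≫ R.src, G.ltι i ≫ R.tgt⟩
  map f := GraphOver.homMk (G.lt.map f)
    (by rw [← Category.assoc, lt_map_ltι]) (by rw [← Category.assoc, lt_map_ltι])
  map_id i := GraphOver.hom_ext (G.lt.map_id i)
  map_comp f g := GraphOver.hom_ext (G.lt.map_comp f g)

/-- The canonical morphism of graphs `R_{<i} ⟶ R`. -/
noncomputable def ltGraphι {E' : C} {R : GraphOver E'} (G : Filtration I R.obj) (i : I) :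
    G.ltGraph.obj i ⟶ R :=
  GraphOver.homMk (G.ltι i) rfl rfl

end Filtration

/-! ### Terminating graphs, strategies, local confluence -/

section Rewriting

variable [HasColimitsOfSize.{w, w} C] [HasPullbacks C] [HasCountableCoproducts C]

/-- A terminating graph `(R, h, h^τ)` over the `I`-filtered object `E`. -/
structure TerminatingGraph {I : Type w} [PartialOrder I] {E : C} (F : Filtration I E) where
  R : GraphOver E
  h : E ⟶ (R.sum (GraphOver.unit E)).obj
  hτ : F.obj ⟶ F.lt
  wellFounded : WellFoundedLT I
  h_src : h ≫ (R.sum (GraphOver.unit E)).src = 𝟙 E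
  ι_h : ∀ i, IsMin i → F.inj i ≫ h = F.inj i ≫ R.sumUnit
  ι_h_tgt : ∀ i, F.inj i ≫ h ≫ (R.sum (GraphOver.unit E)).tgt = hτ.app i ≫ F.ltι i
  /-- On a minimal `i`, `h^τ_i` is the identity of `E_{<i} = E_i`. -/
  hτ_min : ∀ (i) (hi : IsMin i), hτ.app i = F.toLtOfIsMin i hi

/-- A (global) strategy for a graph `R` on a filtered object `E`. -/
@[ext]
structure Strategy {I : Type w} [PartialOrder I] {E : C} (F : Filtration I E)
    (R : GraphOver E) where
  H : E ⟶ R.obj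
  Hτ : E ⟶ F.min
  H_src : H ≫ R.src = 𝟙 E
  H_tgt : H ≫ R.tgt = Hτ ≫ F.minι
  min_Hτ : F.minι ≫ Hτ = 𝟙 F.min

/-- A strategy is confluent if `H^τ` coequalizes the source and the target. -/
def Strategy.Confluent {I : Type w} [PartialOrder I] {E : C} {F : Filtration I E}
    {R : GraphOver E} (S : Strategy F R) : Prop :=
  R.src ≫ S.Hτ = R.tgt ≫ S.Hτ

/-- A composition `μ : (R + E) R^sym ⟶ R^sym`: a morphism of graphs for which the identity
steps (the summand `E` of `R + E`) are neutral. -/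
structure Composition {E : C} (R : GraphOver E) where
  mul : (R.sum (GraphOver.unit E)).prod R.sym ⟶ R.sym
  unit_mul : GraphOver.pair (R.sym.src ≫ R.sumUnit) (𝟙 R.sym.obj)
    (by rw [Category.assoc, GraphOver.sumUnit_tgt, Category.comp_id, Category.id_comp]) ≫
      mul.hom = 𝟙 R.sym.obj

/-- The strategy `(H, H^τ)` on `R^sym` is induced by `(R, h, h^τ)` by means of the
composition `μ`: `H = μ ∘ ⟨h, H ∘ t ∘ h⟩` and `H^τ = H^τ ∘ t ∘ h`, where `t` is the target map of
`R + E`, and `H` is the identity path on every `E_i` with `i` minimal. -/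
structure Strategy.IsInduced {I : Type w} [PartialOrder I] {E : C} {F : Filtration I E}
    (T : TerminatingGraph F) (μ : Composition T.R) (S : Strategy F T.R.sym) : Prop where
  H_eq : S.H = GraphOver.pair T.h ((T.h ≫ (T.R.sum (GraphOver.unit E)).tgt) ≫ S.H)
    (by rw [Category.assoc, S.H_src, Category.comp_id]) ≫ μ.mul.hom
  Hτ_eq : S.Hτ = T.h ≫ (T.R.sum (GraphOver.unit E)).tgt ≫ S.Hτ
  ι_H : ∀ i, IsMin i → F.inj i ≫ S.H = F.inj i ≫ T.R.symUnit

/-- A local-confluence structure on a terminating graph, indexed by a totally ordered set `J`. -/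
structure LcStructure {I : Type w} [PartialOrder I] {E : C} {F : Filtration I E}
    (T : TerminatingGraph F) (J : Type w) [LinearOrder J] where
  G : Filtration J T.R.obj
  wellFounded : WellFoundedLT J
  min_isInitial : Nonempty (IsInitial G.min)
  c : G.obj ⟶ G.ltGraph ⋙ GraphOver.symFunctor E ⋙ GraphOver.forget E
  c_src : ∀ j, c.app j ≫ ((GraphOver.symFunctor E).map (G.ltGraphι j)).hom ≫ T.R.sym.src =
    G.inj j ≫ T.R.src ≫ T.h ≫ (T.R.sum (GraphOver.unit E)).tgt
  c_tgt : ∀ j, c.app j ≫ ((GraphOver.symFunctor E).map (G.ltGraphι j)).hom ≫ T.R.sym.tgt =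
    G.inj j ≫ T.R.tgt

end Rewriting

end GraphRewriting

/-!
# Newman's lemma for graphs

Write `p = t_{R+E} ∘ h : E ⟶ E` (`TerminatingGraph.step`) for one step of `h`. As `h^τ` sends `E_i`
into `E_{<i}` and `I` is terminating, `p` can be iterated until it reaches `E_min`. This takes two
forms.

* *Uniqueness* (`TerminatingGraph.hom_ext`): a map out of `E` is determined by its restriction to
  `E_min` if its value at a generalized element `a` is determined by its value at `p a`. In
  particular, two maps invariant under `p` are equal if they agree on `E_min`.
* *Existence* (`TerminatingGraph.exists_recursion`): a rule computing a value at `a` from `a` and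
  a value at `p a`, with compatible initial values on `E_min`, is solved by a map out of `E`. Local
  solutions on the `E_i` are unique and stable under restriction, so they glue over `E_{<i}`, then
  over `E`. Values may be constrained to lie over a map `E ⟶ B`: for the strategy `H : E ⟶ R^sym`,
  this constraint is that the path `H a` starts at `a`, without which it could not be composed with
  `h`.

Existence gives the normal form map `N` and, for each composition `μ`, the strategy `H`; uniqueness
shows that they are unique, and that the target of `H` is `ι_min ∘ N`, both being invariant under
`p`.

Confluence comes from `LcStructure.equalizes`: a map `f` with `f ∘ p = f` satisfies
`f ∘ s_R = f ∘ t_R`. By induction on `j`, it equalizes the graph `R_{<j}`, hence `(R_{<j})^sym`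
(`GraphOver.sym_equalizes`), and the path `c_j` then identifies the values of `f` at the target of
an element of `R_j` and at the successor of its source. Conversely a map equalizing `R` is invariant
under `p`, as `h` is a section of the source map of `R + E`. So the maps out of `E` that equalize
`R`, or `R^sym`, are those invariant under `p`; they factor uniquely through `N`, which is therefore
a coequalizer of both graphs.
-/

namespace GraphRewriting

variable {C : Type u} [Category.{v} C]

/-! ### Maps equalizing the source and the target of a graph -/

namespace GraphOver

variable {E X : C} {R S : GraphOver E} {f : E ⟶ X}

theorem unit_equalizes : (unit E).src ≫ f = (unit E).tgt ≫ f := rfl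

section Prod

variable [HasPullbacks C]

theorem prod_equalizes (hR : R.src ≫ f = R.tgt ≫ f) (hS : S.src ≫ f = S.tgt ≫ f) :
    (prod R S).src ≫ f = (prod R S).tgt ≫ f := by
  change (pullback.fst R.tgt S.src ≫ R.src) ≫ f = (pullback.snd R.tgt S.src ≫ S.tgt) ≫ f
  rw [Category.assoc, Category.assoc, hR, ← hS, pullback.condition_assoc]

theorem iter_equalizes (hR : R.src ≫ f = R.tgt ≫ f) (n : ℕ) :
    (iter R n).src ≫ f = (iter R n).tgt ≫ f := by
  induction n with
  | zero => exact hR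
  | succ n ih => exact prod_equalizes hR ih

end Prod

section Sum

variable [HasCountableCoproducts C]

/-- The coprojection of `R` into `R + S`. -/
noncomputable def sumInl (R S : GraphOver E) : R ⟶ sum R S :=
  homMk (coprod.inl : R.obj ⟶ R.obj ⨿ S.obj) (coprod.inl_desc _ _) (coprod.inl_desc _ _)

theorem sum_equalizes (hR : R.src ≫ f = R.tgt ≫ f) (hS : S.src ≫ f = S.tgt ≫ f) :
    (sum R S).src ≫ f = (sum R S).tgt ≫ f := by
  change coprod.desc R.src S.src ≫ f = coprod.desc R.tgt S.tgt ≫ f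
  apply coprod.hom_ext
  · rw [coprod.inl_desc_assoc, coprod.inl_desc_assoc, hR]
  · rw [coprod.inr_desc_assoc, coprod.inr_desc_assoc, hS]

end Sum

section Closure

variable [HasPullbacks C] [HasCountableCoproducts C]

theorem plus_equalizes (hR : R.src ≫ f = R.tgt ≫ f) :
    (plus R).src ≫ f = (plus R).tgt ≫ f := by
  apply Limits.Sigma.hom_ext
  intro n
  change Limits.Sigma.ι _ n ≫ Limits.Sigma.desc _ ≫ f =
    Limits.Sigma.ι _ n ≫ Limits.Sigma.desc _ ≫ f
  rw [Limits.Sigma.ι_desc_assoc, Limits.Sigma.ι_desc_assoc, iter_equalizes hR n]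

theorem sym_equalizes (hR : R.src ≫ f = R.tgt ≫ f) : R.sym.src ≫ f = R.sym.tgt ≫ f :=
  sum_equalizes (plus_equalizes (sum_equalizes hR hR.symm)) unit_equalizes

/-- The inclusion of `R` into `R⁺` as the paths of length one. -/
noncomputable def toPlus (R : GraphOver E) : R ⟶ plus R :=
  homMk (Limits.Sigma.ι (fun n : ℕ => (iter R n).obj) 0) (Limits.Sigma.ι_desc _ _)
    (Limits.Sigma.ι_desc _ _)

/-- The inclusion of `R` into `(R + R°)*` as the paths of length one. -/
noncomputable def toSym (R : GraphOver E) : R ⟶ sym R :=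
  sumInl R (opp R) ≫ toPlus (sum R (opp R)) ≫ sumInl (plus (sum R (opp R))) (unit E)

theorem sym_equalizes_iff :
    R.sym.src ≫ f = R.sym.tgt ≫ f ↔ R.src ≫ f = R.tgt ≫ f := by
  refine ⟨fun h => ?_, sym_equalizes⟩
  rw [← hom_src (toSym R), ← hom_tgt (toSym R), Category.assoc, Category.assoc, h]

/-- `E/R` and `E/R^sym` agree, as `R` and `R^sym` are equalized by the same maps. -/
noncomputable def coequalizerSymIso (R : GraphOver E) [HasCoequalizers C] :
    coequalizer R.src R.tgt ≅ coequalizer R.sym.src R.sym.tgt where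
  hom := coequalizer.desc (coequalizer.π _ _)
    (sym_equalizes_iff.1 (coequalizer.condition R.sym.src R.sym.tgt))
  inv := coequalizer.desc (coequalizer.π _ _)
    (sym_equalizes (coequalizer.condition R.src R.tgt))
  hom_inv_id := by
    apply coequalizer.hom_ext
    rw [coequalizer.π_desc_assoc, coequalizer.π_desc, Category.comp_id]
  inv_hom_id := by
    apply coequalizer.hom_ext
    rw [coequalizer.π_desc_assoc, coequalizer.π_desc, Category.comp_id]

end Closure

end GraphOver

/-! ### Maps out of a filtered object -/

namespace Filtration

variable {I : Type w} [PartialOrder I] {E : C} (F : Filtration I E)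

theorem hom_ext {X : C} {f g : E ⟶ X} (h : ∀ i, F.inj i ≫ f = F.inj i ≫ g) : f = g :=
  F.isColimit.hom_ext h

theorem exists_desc {X : C} (x : ∀ i, F.obj.obj i ⟶ X)
    (hx : ∀ (i j : I) (h : i ≤ j), F.obj.map (homOfLE h) ≫ x j = x i) :
    ∃ f : E ⟶ X, ∀ i, F.inj i ≫ f = x i :=
  ⟨F.isColimit.desc
    { pt := X
      ι :=
        { app := x
          naturality := fun i j g => (hx i j (leOfHom g)).trans (Category.comp_id _).symm } },
    fun i => F.isColimit.fac _ i⟩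

variable [HasColimitsOfSize.{w, w} C]

theorem toOn_onι (S : Set I) (k : I) (hk : k ∈ S) : F.toOn S k hk ≫ F.onι S = F.inj k :=
  F.toOn_onDesc _ _ _ _ _

/-- The canonical morphism `E_k ⟶ E_{<i}`. -/
noncomputable def toLt (i k : I) (hk : k ∈ below i) : F.obj.obj k ⟶ F.lt.obj i :=
  F.toOn (below i) k hk

/-- The morphism out of `E_{<i}` induced by a compatible family. -/
noncomputable def ltDesc (i : I) {X : C} (f : ∀ k, k ∈ below i → (F.obj.obj k ⟶ X))
    (hf : ∀ (k l : I) (hk : k ∈ below i) (hl : l ∈ below i) (h : k ≤ l),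
      F.obj.map (homOfLE h) ≫ f l hl = f k hk) : F.lt.obj i ⟶ X :=
  F.onDesc (below i) f hf

theorem toLt_ltDesc (i : I) {X : C} (f : ∀ k, k ∈ below i → (F.obj.obj k ⟶ X))
    (hf : ∀ (k l : I) (hk : k ∈ below i) (hl : l ∈ below i) (h : k ≤ l),
      F.obj.map (homOfLE h) ≫ f l hl = f k hk) (k : I) (hk : k ∈ below i) :
    F.toLt i k hk ≫ F.ltDesc i f hf = f k hk :=
  F.toOn_onDesc _ _ _ _ _

theorem lt_hom_ext {i : I} {X : C} {f g : F.lt.obj i ⟶ X}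
    (h : ∀ k hk, F.toLt i k hk ≫ f = F.toLt i k hk ≫ g) : f = g :=
  F.on_hom_ext h

theorem toLt_ltι (i k : I) (hk : k ∈ below i) : F.toLt i k hk ≫ F.ltι i = F.inj k :=
  F.toOn_onι _ k hk

theorem toLt_lt_map {i j k : I} (h : i ≤ j) (hk : k ∈ below i) :
    F.toLt i k hk ≫ F.lt.map (homOfLE h) = F.toLt j k (below_subset h hk) :=
  F.toOn_onDesc _ _
    (fun _ _ hl hl' hll' => F.map_toOn _ (below_subset h hl) (below_subset h hl') hll') _ _

theorem toOn_minι (i : I) (hi : IsMin i) : F.toOn (minimals I) i hi ≫ F.minι = F.inj i :=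
  F.toOn_onι _ i hi

theorem minι_comp_eq_iff {X : C} {f g : E ⟶ X} :
    F.minι ≫ f = F.minι ≫ g ↔ ∀ i, IsMin i → F.inj i ≫ f = F.inj i ≫ g := by
  refine ⟨fun h i hi => ?_, fun h => F.on_hom_ext fun i hi => ?_⟩
  · rw [← F.toOn_minι i hi, Category.assoc, h, Category.assoc]
  · rw [← Category.assoc, ← Category.assoc, F.toOn_minι i hi, h i hi]

theorem le_of_mem_below {i k : I} (hk : k ∈ below i) : k ≤ i :=
  hk.elim le_of_lt fun h => h.1.le

theorem lt_of_mem_below {i k : I} (hi : ¬IsMin i) (hk : k ∈ below i) : k < i :=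
  hk.resolve_right fun h => hi (h.1 ▸ h.2)

/-- The canonical morphism `E_{<i} ⟶ E_i`. -/
noncomputable def ltToObj (i : I) : F.lt.obj i ⟶ F.obj.obj i :=
  F.ltDesc i (fun _ hk => F.obj.map (homOfLE (le_of_mem_below hk)))
    fun _ _ _ _ _ => (F.obj.map_comp _ _).symm

theorem toLt_ltToObj (i k : I) (hk : k ∈ below i) :
    F.toLt i k hk ≫ F.ltToObj i = F.obj.map (homOfLE (le_of_mem_below hk)) :=
  F.toLt_ltDesc _ _ _ _ _

theorem ltToObj_inj (i : I) : F.ltToObj i ≫ F.inj i = F.ltι i :=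
  F.lt_hom_ext fun k hk => by
    rw [← Category.assoc, F.toLt_ltToObj, F.map_ι, F.toLt_ltι]

theorem ltToObj_naturality {i j : I} (h : i ≤ j) :
    F.lt.map (homOfLE h) ≫ F.ltToObj j = F.ltToObj i ≫ F.obj.map (homOfLE h) :=
  F.lt_hom_ext fun k hk => by
    rw [← Category.assoc, ← Category.assoc, F.toLt_lt_map, F.toLt_ltToObj, F.toLt_ltToObj,
      ← F.obj.map_comp]
    rfl

theorem toLtOfIsMin_ltToObj (i : I) (hi : IsMin i) :
    F.toLtOfIsMin i hi ≫ F.ltToObj i = 𝟙 _ :=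
  (F.toLt_ltToObj i i _).trans (F.obj.map_id i)

end Filtration

/-! ### Recursion along a terminating graph -/

namespace TerminatingGraph

variable [HasColimitsOfSize.{w, w} C] [HasCountableCoproducts C]
  {I : Type w} [PartialOrder I] {E : C} {F : Filtration I E} (T : TerminatingGraph F)

/-- The endomorphism `t_{R+E} ∘ h` of `E`: one step of `h`. -/
noncomputable def step : E ⟶ E := T.h ≫ (T.R.sum (GraphOver.unit E)).tgt

theorem inj_step (i : I) : F.inj i ≫ T.step = T.hτ.app i ≫ F.ltι i := T.ι_h_tgt i

theorem minι_h : F.minι ≫ T.h = F.minι ≫ T.R.sumUnit :=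
  F.minι_comp_eq_iff.2 T.ι_h

theorem minι_step : F.minι ≫ T.step = F.minι := by
  rw [step, ← Category.assoc, T.minι_h, Category.assoc, GraphOver.sumUnit_tgt, Category.comp_id]

/-- Steps of `h` are invisible to a map equalizing `R`, because `h` is a section of the source
map of `R + E`. -/
theorem step_comp_of_equalizes {X : C} {f : E ⟶ X} (hf : T.R.src ≫ f = T.R.tgt ≫ f) :
    T.step ≫ f = f := by
  rw [step, Category.assoc,
    ← GraphOver.sum_equalizes (S := GraphOver.unit E) hf GraphOver.unit_equalizes,
    ← Category.assoc, T.h_src, Category.id_comp]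

/-- Well-founded induction: two maps are equal if they agree on `E_min` and if, at every
generalized element `a` of `E`, their agreement at the successor of `a` implies their agreement
at `a`. -/
theorem hom_ext {X : C} {f g : E ⟶ X} (hmin : F.minι ≫ f = F.minι ≫ g)
    (hstep : ∀ (Y : C) (a : Y ⟶ E), a ≫ T.step ≫ f = a ≫ T.step ≫ g → a ≫ f = a ≫ g) :
    f = g := by
  have := T.wellFounded
  refine F.hom_ext fun i => ?_
  induction i using WellFoundedLT.induction with
  | ind i ih =>
    by_cases hi : IsMin i
    · exact F.minι_comp_eq_iff.1 hmin i hi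
    · apply hstep
      rw [← Category.assoc, ← Category.assoc, T.inj_step, Category.assoc, Category.assoc]
      congr 1
      refine F.lt_hom_ext fun k hk => ?_
      rw [← Category.assoc, ← Category.assoc, F.toLt_ltι,
        ih k (Filtration.lt_of_mem_below hi hk)]

theorem hom_ext_of_step_comp {X : C} {f g : E ⟶ X} (hf : T.step ≫ f = f) (hg : T.step ≫ g = g)
    (hmin : F.minι ≫ f = F.minι ≫ g) : f = g :=
  T.hom_ext hmin fun Y a h => by rwa [hf, hg] at h

section Recursion

variable [HasPullbacks C] {X B : C} (s : X ⟶ B) (b : E ⟶ B)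
  (φ : pullback (T.step ≫ b) s ⟶ X) (m : F.min ⟶ X)

/-- `x : E_i ⟶ X` solves, over `E_i`, the recursive equation `x = φ(id, x ∘ step)` over `B` with
initial values `m`. The second argument of `φ` makes sense since `h^τ` takes `E_i` to `E_{<i}`. -/
structure IsSolutionAt (i : I) (x : F.obj.obj i ⟶ X) : Prop where
  comp_s : x ≫ s = F.inj i ≫ b
  eq_of_isMin : ∀ (k : I) (hk : IsMin k) (h : k ≤ i),
    F.obj.map (homOfLE h) ≫ x = F.toOn (Filtration.minimals I) k hk ≫ m
  eq_φ : ∃ y : F.obj.obj i ⟶ pullback (T.step ≫ b) s, y ≫ pullback.fst _ _ = F.inj i ∧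
    y ≫ pullback.snd _ _ = T.hτ.app i ≫ F.ltToObj i ≫ x ∧ y ≫ φ = x

variable {s b φ m}

theorem IsSolutionAt.restrict {i k : I} (h : k ≤ i) {x : F.obj.obj i ⟶ X}
    (hx : T.IsSolutionAt s b φ m i x) :
    T.IsSolutionAt s b φ m k (F.obj.map (homOfLE h) ≫ x) where
  comp_s := by rw [Category.assoc, hx.comp_s, ← Category.assoc, F.map_ι]
  eq_of_isMin l hl hlk := by
    rw [← hx.eq_of_isMin l hl (hlk.trans h), ← Category.assoc, ← F.obj.map_comp]; rfl
  eq_φ := by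
    obtain ⟨y, h₁, h₂, h₃⟩ := hx.eq_φ
    refine ⟨F.obj.map (homOfLE h) ≫ y, ?_, ?_, ?_⟩
    · rw [Category.assoc, h₁, F.map_ι]
    · rw [Category.assoc, h₂, ← Category.assoc, T.hτ.naturality, Category.assoc,
        ← Category.assoc (F.lt.map _), F.ltToObj_naturality, Category.assoc]
    · rw [Category.assoc, h₃]

theorem IsSolutionAt.unique {i : I} {x x' : F.obj.obj i ⟶ X}
    (hx : T.IsSolutionAt s b φ m i x) (hx' : T.IsSolutionAt s b φ m i x') : x = x' := by
  have := T.wellFounded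
  induction i using WellFoundedLT.induction with
  | ind i ih =>
    by_cases hi : IsMin i
    · have h := (hx.eq_of_isMin i hi le_rfl).trans (hx'.eq_of_isMin i hi le_rfl).symm
      rwa [show homOfLE (le_refl i) = 𝟙 i from rfl, F.obj.map_id, Category.id_comp,
        Category.id_comp] at h
    · have hlt : F.ltToObj i ≫ x = F.ltToObj i ≫ x' := by
        refine F.lt_hom_ext fun k hk => ?_
        rw [← Category.assoc, ← Category.assoc, F.toLt_ltToObj]
        exact ih k (Filtration.lt_of_mem_below hi hk) (hx.restrict T _) (hx'.restrict T _)
      obtain ⟨y, h₁, h₂, h₃⟩ := hx.eq_φ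
      obtain ⟨y', h₁', h₂', h₃'⟩ := hx'.eq_φ
      rw [← h₃, ← h₃']
      congr 1
      apply pullback.hom_ext
      · rw [h₁, h₁']
      · rw [h₂, h₂', hlt]

/-- Existence of local solutions, by well-founded induction: the solutions at all `k < i` agree by
uniqueness, so they glue over `E_{<i}`, and `φ` extends the result to `E_i`. -/
theorem exists_isSolutionAt (hφ : φ ≫ s = pullback.fst _ _ ≫ b) (hms : m ≫ s = F.minι ≫ b)
    (hm : ∃ y : F.min ⟶ pullback (T.step ≫ b) s,
      y ≫ pullback.fst _ _ = F.minι ∧ y ≫ pullback.snd _ _ = m ∧ y ≫ φ = m) (i : I) :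
    ∃ x, T.IsSolutionAt s b φ m i x := by
  have := T.wellFounded
  induction i using WellFoundedLT.induction with
  | ind i ih =>
    by_cases hi : IsMin i
    · refine ⟨F.toOn (Filtration.minimals I) i hi ≫ m, ?_, ?_, ?_⟩
      · rw [Category.assoc, hms, ← Category.assoc, F.toOn_minι]
      · intro k hk h
        rw [← Category.assoc, F.map_toOn _ hk]
      · obtain ⟨y, h₁, h₂, h₃⟩ := hm
        refine ⟨F.toOn (Filtration.minimals I) i hi ≫ y, ?_, ?_, ?_⟩
        · rw [Category.assoc, h₁, F.toOn_minι]
        · rw [Category.assoc, h₂, T.hτ_min i hi, ← Category.assoc (F.toLtOfIsMin i hi),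
            F.toLtOfIsMin_ltToObj, Category.id_comp]
        · rw [Category.assoc, h₃]
    · have hlt : ∀ k, k ∈ Filtration.below i → k < i := fun k => Filtration.lt_of_mem_below hi
      choose x hx using ih
      -- the map out of `E_{<i}` glued from the solutions below `i`
      let g : F.lt.obj i ⟶ X := F.ltDesc i (fun k hk => x k (hlt k hk))
        fun k l hk hl h => ((hx l (hlt l hl)).restrict T h).unique T (hx k (hlt k hk))
      have hg : ∀ k (hk : k ∈ Filtration.below i), F.toLt i k hk ≫ g = x k (hlt k hk) :=
        fun k hk => F.toLt_ltDesc _ _ _ _ _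
      have hgs : g ≫ s = F.ltι i ≫ b := F.lt_hom_ext fun k hk => by
        rw [← Category.assoc, ← Category.assoc, hg, (hx k _).comp_s, F.toLt_ltι]
      let y : F.obj.obj i ⟶ pullback (T.step ≫ b) s :=
        pullback.lift (F.inj i) (T.hτ.app i ≫ g)
          (by rw [← Category.assoc, T.inj_step, Category.assoc, Category.assoc, hgs])
      have hy₁ : y ≫ pullback.fst _ _ = F.inj i := pullback.lift_fst _ _ _
      have hy₂ : y ≫ pullback.snd _ _ = T.hτ.app i ≫ g := pullback.lift_snd _ _ _
      -- the map built from `φ` extends the solutions below `i`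
      have hmap : ∀ k (hk : k < i), F.obj.map (homOfLE hk.le) ≫ y ≫ φ = x k hk := by
        intro k hk
        obtain ⟨z, h₁, h₂, h₃⟩ := (hx k hk).eq_φ
        rw [← h₃, ← Category.assoc]
        congr 1
        have hgk : F.lt.map (homOfLE hk.le) ≫ g = F.ltToObj k ≫ x k hk :=
          F.lt_hom_ext fun l hl => by
            rw [← Category.assoc, ← Category.assoc, F.toLt_lt_map, hg, F.toLt_ltToObj]
            exact (hx l _).unique T ((hx k hk).restrict T _)
        apply pullback.hom_ext
        · rw [Category.assoc, hy₁, h₁, F.map_ι]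
        · rw [Category.assoc, hy₂, h₂, ← Category.assoc, T.hτ.naturality, Category.assoc, hgk]
      refine ⟨y ≫ φ, ?_, ?_, y, hy₁, ?_, rfl⟩
      · rw [Category.assoc, hφ, ← Category.assoc, hy₁]
      · intro k hk h
        have hki : k < i := h.lt_of_ne fun e => hi (e ▸ hk)
        rw [hmap k hki, ← (hx k hki).eq_of_isMin k hk le_rfl]
        exact ((congrArg (· ≫ x k hki) (F.obj.map_id k)).trans (Category.id_comp _)).symm
      · rw [hy₂]
        congr 1
        refine F.lt_hom_ext fun k hk => ?_
        rw [hg, ← Category.assoc (F.toLt i k hk), F.toLt_ltToObj, hmap k (hlt k hk)]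

/-- Recursion along `step`: for `X` over `B`, a map `φ` that computes a value at a generalized
element `a` of `E` from `a` and a value at its successor, and initial values `m` on `E_min`
compatible with `φ`, determine a map `f : E ⟶ X` over `B` with `f = φ(id, f ∘ step)`. -/
theorem exists_recursion (hφ : φ ≫ s = pullback.fst _ _ ≫ b) (hms : m ≫ s = F.minι ≫ b)
    (hm : ∃ y : F.min ⟶ pullback (T.step ≫ b) s,
      y ≫ pullback.fst _ _ = F.minι ∧ y ≫ pullback.snd _ _ = m ∧ y ≫ φ = m) :
    ∃ f : E ⟶ X, f ≫ s = b ∧ F.minι ≫ f = m ∧ ∃ y : E ⟶ pullback (T.step ≫ b) s,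
      y ≫ pullback.fst _ _ = 𝟙 E ∧ y ≫ pullback.snd _ _ = T.step ≫ f ∧ y ≫ φ = f := by
  choose x hx using T.exists_isSolutionAt hφ hms hm
  obtain ⟨f, hf⟩ := F.exists_desc x fun i j h => ((hx j).restrict T h).unique T (hx i)
  have hfs : f ≫ s = b := F.hom_ext fun i => by
    rw [← Category.assoc, hf, (hx i).comp_s]
  have hlt : ∀ i, F.ltι i ≫ f = F.ltToObj i ≫ x i := fun i => by
    rw [← hf, ← Category.assoc, F.ltToObj_inj]
  refine ⟨f, hfs, ?_, pullback.lift (𝟙 E) (T.step ≫ f) ?_, pullback.lift_fst _ _ _,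
    pullback.lift_snd _ _ _, ?_⟩
  · refine F.on_hom_ext fun i hi => ?_
    rw [← Category.assoc, F.toOn_minι, hf, ← (hx i).eq_of_isMin i hi le_rfl]
    exact ((congrArg (· ≫ x i) (F.obj.map_id i)).trans (Category.id_comp _)).symm
  · rw [Category.id_comp, Category.assoc, hfs]
  · refine F.hom_ext fun i => ?_
    obtain ⟨y, h₁, h₂, h₃⟩ := (hx i).eq_φ
    rw [hf, ← h₃, ← Category.assoc]
    congr 1
    apply pullback.hom_ext
    · rw [Category.assoc, pullback.lift_fst, Category.comp_id, h₁]
    · rw [Category.assoc, pullback.lift_snd, ← Category.assoc, T.inj_step, h₂, Category.assoc,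
        hlt]

end Recursion

/-! ### The normal form map -/

theorem exists_normalForm [HasPullbacks C] :
    ∃ N : E ⟶ F.min, F.minι ≫ N = 𝟙 F.min ∧ T.step ≫ N = N := by
  -- There is no constraint on values here. They are taken over the quotient of `E` by `step`,
  -- where the constraint is automatic.
  let b := coequalizer.π T.step (𝟙 E)
  have hb : T.step ≫ b = b := (coequalizer.condition T.step (𝟙 E)).trans (Category.id_comp _)
  obtain ⟨N, -, hN, y, -, h₂, h₃⟩ := T.exists_recursion (s := F.minι ≫ b) (b := b)
    (φ := pullback.snd _ _) (m := 𝟙 F.min)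
    (pullback.condition.symm.trans (congrArg _ hb)) (Category.id_comp _)
    ⟨pullback.lift F.minι (𝟙 _) (by rw [hb, Category.id_comp]), pullback.lift_fst _ _ _,
      pullback.lift_snd _ _ _, pullback.lift_snd _ _ _⟩
  exact ⟨N, hN, h₂.symm.trans h₃⟩

end TerminatingGraph

/-! ### Local confluence implies confluence -/

namespace LcStructure

variable [HasColimitsOfSize.{w, w} C] [HasPullbacks C] [HasCountableCoproducts C]
  {I : Type w} [PartialOrder I] {E : C} {F : Filtration I E} {T : TerminatingGraph F}
  {J : Type w} [LinearOrder J]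

/-- In the totally ordered set `J` there is at most one minimal element `j`, so that `R_j` is
`R_min`, hence initial. -/
theorem hom_eq_of_isMin (L : LcStructure T J) {j : J} (hj : IsMin j) {X : C}
    (f g : L.G.obj.obj j ⟶ X) : f = g := by
  obtain ⟨hI⟩ := L.min_isInitial
  let r : L.G.min ⟶ L.G.obj.obj j := L.G.onDesc _
    (fun k hk => L.G.obj.map (homOfLE ((le_total k j).elim id fun h => hk h)))
    fun _ _ _ _ _ => (L.G.obj.map_comp _ _).symm
  have hr : L.G.toOn _ j hj ≫ r = 𝟙 _ :=
    (L.G.toOn_onDesc _ _ _ _ _).trans (L.G.obj.map_id j)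
  rw [← Category.id_comp f, ← Category.id_comp g, ← hr, Category.assoc, Category.assoc,
    hI.hom_ext (r ≫ f) (r ≫ g)]

/-- The heart of Newman's lemma: a map invariant under `step` equalizes `R`. By induction on `j`,
it equalizes `R_{<j}`, hence `(R_{<j})^sym`, so by local confluence it takes the same value at the
target of an element of `R_j` and at the successor of its source. -/
theorem equalizes (L : LcStructure T J) {X : C} {f : E ⟶ X} (hf : T.step ≫ f = f) :
    T.R.src ≫ f = T.R.tgt ≫ f := by
  have := L.wellFounded
  refine L.G.hom_ext fun j => ?_
  induction j using WellFoundedLT.induction with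
  | ind j ih =>
    by_cases hj : IsMin j
    · exact L.hom_eq_of_isMin hj _ _
    · have hlt : (L.G.ltGraph.obj j).src ≫ f = (L.G.ltGraph.obj j).tgt ≫ f := by
        refine L.G.lt_hom_ext fun k hk => ?_
        change L.G.toLt j k hk ≫ (L.G.ltι j ≫ T.R.src) ≫ f =
          L.G.toLt j k hk ≫ (L.G.ltι j ≫ T.R.tgt) ≫ f
        have h := ih k (Filtration.lt_of_mem_below hj hk)
        rw [← L.G.toLt_ltι j k hk] at h
        simpa only [Category.assoc] using h
      have hsym := GraphOver.sym_equalizes hlt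
      have h₁ := L.c_src j
      have h₂ := L.c_tgt j
      have hs := ((GraphOver.symFunctor E).map (L.G.ltGraphι j)).w_src
      have ht := ((GraphOver.symFunctor E).map (L.G.ltGraphι j)).w_tgt
      have h₁' : L.c.app j ≫ (L.G.ltGraph.obj j).sym.src = L.G.inj j ≫ T.R.src ≫ T.step :=
        (congrArg (L.c.app j ≫ ·) hs).symm.trans h₁
      have h₂' : L.c.app j ≫ (L.G.ltGraph.obj j).sym.tgt = L.G.inj j ≫ T.R.tgt :=
        (congrArg (L.c.app j ≫ ·) ht).symm.trans h₂
      calc L.G.inj j ≫ T.R.src ≫ f = (L.G.inj j ≫ T.R.src ≫ T.step) ≫ f := by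
            rw [Category.assoc, Category.assoc, hf]
        _ = (L.G.inj j ≫ T.R.tgt) ≫ f := by
            rw [← h₁', ← h₂']
            exact (Category.assoc _ _ _).trans
              ((congrArg (L.c.app j ≫ ·) hsym).trans (Category.assoc _ _ _).symm)
        _ = L.G.inj j ≫ T.R.tgt ≫ f := Category.assoc _ _ _

end LcStructure

/-! ### Strategies -/

section Strategies

variable [HasColimitsOfSize.{w, w} C] {I : Type w} [PartialOrder I] {E : C} {F : Filtration I E}

/-- A retraction of `E_min ⟶ E` equalizing a graph is the target map of every strategy. -/
theorem Strategy.Hτ_eq_of_equalizes {R : GraphOver E} (S : Strategy F R) {N : E ⟶ F.min}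
    (hN : F.minι ≫ N = 𝟙 F.min) (h : R.src ≫ N = R.tgt ≫ N) : S.Hτ = N := by
  rw [← Category.comp_id S.Hτ, ← hN, ← Category.assoc, ← S.H_tgt, Category.assoc, ← h,
    ← Category.assoc, S.H_src, Category.id_comp]

namespace TerminatingGraph

variable [HasPullbacks C] [HasCountableCoproducts C] (T : TerminatingGraph F)
  (μ : Composition T.R)

/-- The first component `H` is obtained by recursion, prefixing a path by the step chosen by `h`.
Its target is invariant under `step`, hence factors through the normal form map `N`. -/
theorem exists_isInduced {N : E ⟶ F.min} (hN : F.minι ≫ N = 𝟙 F.min) (hN' : T.step ≫ N = N) :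
    ∃ S : Strategy F T.R.sym, S.IsInduced T μ := by
  -- prefixing a path by the step that `h` chooses at a given element of `E`
  let q : pullback (T.step ≫ 𝟙 E) T.R.sym.src ⟶
      ((T.R.sum (GraphOver.unit E)).prod T.R.sym).obj :=
    GraphOver.pair (pullback.fst _ _ ≫ T.h) (pullback.snd _ _)
      ((Category.assoc _ _ _).trans ((congrArg _ (Category.comp_id _).symm).trans
        pullback.condition))
  have hq₁ : q ≫ pullback.fst _ _ = pullback.fst _ _ ≫ T.h := pullback.lift_fst _ _ _
  have hq₂ : q ≫ pullback.snd _ _ = pullback.snd _ _ := pullback.lift_snd _ _ _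
  have hqs : (q ≫ μ.mul.hom) ≫ T.R.sym.src = pullback.fst _ _ ≫ 𝟙 E := by
    rw [Category.assoc, μ.mul.w_src]
    refine (Category.assoc _ _ _).symm.trans ((congrArg (· ≫ _) hq₁).trans ?_)
    rw [Category.assoc, T.h_src]
  have hqt : (q ≫ μ.mul.hom) ≫ T.R.sym.tgt = pullback.snd _ _ ≫ T.R.sym.tgt := by
    rw [Category.assoc, μ.mul.w_tgt]
    exact (Category.assoc _ _ _).symm.trans (congrArg (· ≫ _) hq₂)
  have hus := T.R.symUnit_src
  let y₀ : F.min ⟶ pullback (T.step ≫ 𝟙 E) T.R.sym.src :=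
    pullback.lift F.minι (F.minι ≫ T.R.symUnit)
      (by rw [Category.assoc, hus, ← Category.assoc, T.minι_step])
  -- on a normal form, this prefixes the trivial path by the trivial step
  have hy₀ : y₀ ≫ q = (F.minι ≫ T.R.symUnit) ≫
      GraphOver.pair (T.R.sym.src ≫ T.R.sumUnit) (𝟙 T.R.sym.obj)
        (by rw [Category.assoc, GraphOver.sumUnit_tgt, Category.comp_id, Category.id_comp]) := by
    apply pullback.hom_ext
    · rw [Category.assoc, hq₁, pullback.lift_fst_assoc, T.minι_h, Category.assoc]
      refine Eq.trans ?_ (congrArg _ (pullback.lift_fst _ _ _)).symm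
      rw [Category.assoc, ← Category.assoc T.R.symUnit, hus, Category.id_comp]
    · rw [Category.assoc, hq₂, pullback.lift_snd, Category.assoc]
      refine Eq.trans ?_ (congrArg _ (pullback.lift_snd _ _ _)).symm
      rw [Category.comp_id]
  obtain ⟨H, hs, hmin, y, h₁, h₂, h₃⟩ := T.exists_recursion (s := T.R.sym.src) (b := 𝟙 E)
    (φ := q ≫ μ.mul.hom) (m := F.minι ≫ T.R.symUnit) hqs
    (by rw [Category.assoc, hus])
    ⟨y₀, pullback.lift_fst _ _ _, pullback.lift_snd _ _ _,
      (Category.assoc _ _ _).symm.trans ((congrArg (· ≫ μ.mul.hom) hy₀).trans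
        ((Category.assoc _ _ _).trans
          ((congrArg _ μ.unit_mul).trans (Category.comp_id _))))⟩
  have ht : T.step ≫ H ≫ T.R.sym.tgt = H ≫ T.R.sym.tgt := by
    conv_rhs => rw [← h₃, Category.assoc, hqt, ← Category.assoc, h₂, Category.assoc]
  refine ⟨⟨H, N, hs, T.hom_ext_of_step_comp ht ?_ ?_, hN⟩, ?_, ?_, ?_⟩
  · rw [← Category.assoc, hN']
  · rw [← Category.assoc, ← Category.assoc, hmin, hN, Category.id_comp, Category.assoc]
    exact (congrArg _ (coprod.inr_desc _ _)).trans (Category.comp_id _)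
  · refine h₃.symm.trans ((Category.assoc _ _ _).symm.trans (congrArg (· ≫ μ.mul.hom) ?_))
    apply pullback.hom_ext
    · rw [Category.assoc, hq₁, ← Category.assoc, h₁, Category.id_comp]
      exact (pullback.lift_fst _ _ _).symm
    · rw [Category.assoc, hq₂, h₂]
      exact (pullback.lift_snd _ _ _).symm
  · exact (hN'.symm).trans (Category.assoc _ _ _)
  · exact F.minι_comp_eq_iff.1 hmin

end TerminatingGraph

theorem Strategy.IsInduced.unique [HasPullbacks C] [HasCountableCoproducts C]
    {T : TerminatingGraph F} {μ : Composition T.R} {S S' : Strategy F T.R.sym}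
    (hS : S.IsInduced T μ) (hS' : S'.IsInduced T μ) : S = S' := by
  have hmin : F.minι ≫ S.H = F.minι ≫ S'.H :=
    F.minι_comp_eq_iff.2 fun i hi => (hS.ι_H i hi).trans (hS'.ι_H i hi).symm
  refine Strategy.ext (T.hom_ext hmin fun Y a h => ?_) ?_
  · rw [hS.H_eq, hS'.H_eq]
    refine (Category.assoc _ _ _).symm.trans
      ((congrArg (· ≫ μ.mul.hom) ?_).trans (Category.assoc _ _ _))
    apply pullback.hom_ext
    · exact (Category.assoc _ _ _).trans ((congrArg _ (pullback.lift_fst _ _ _)).trans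
        ((congrArg _ (pullback.lift_fst _ _ _)).symm.trans (Category.assoc _ _ _).symm))
    · exact (Category.assoc _ _ _).trans ((congrArg _ (pullback.lift_snd _ _ _)).trans
        (h.trans ((congrArg _ (pullback.lift_snd _ _ _)).symm.trans (Category.assoc _ _ _).symm)))
  · refine T.hom_ext_of_step_comp ?_ ?_ (S.min_Hτ.trans S'.min_Hτ.symm)
    · exact (Category.assoc _ _ _).trans hS.Hτ_eq.symm
    · exact (Category.assoc _ _ _).trans hS'.Hτ_eq.symm

end Strategies

end GraphRewriting

theorem mainTheorem1 {C : Type u} [Category.{v} C] [IsLocallyFinitelyPresentable.{w} C]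
    {I : Type w} [PartialOrder I] [Nonempty I] [IsDirectedOrder I]
    {J : Type w} [LinearOrder J] [Nonempty J]
    {E : C} (F : GraphRewriting.Filtration I E) (T : GraphRewriting.TerminatingGraph F)
    (L : GraphRewriting.LcStructure T J) :
    ∃ N : E ⟶ F.min,
      -- `N` is the normal form map determined by `(R, h, h^τ)`
      (F.minι ≫ N = 𝟙 F.min ∧ N = T.h ≫ (T.R.sum (GraphRewriting.GraphOver.unit E)).tgt ≫ N) ∧
      (∀ N' : E ⟶ F.min, F.minι ≫ N' = 𝟙 F.min →
        N' = T.h ≫ (T.R.sum (GraphRewriting.GraphOver.unit E)).tgt ≫ N' → N' = N) ∧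
      T.R.sym.src ≫ N = T.R.sym.tgt ≫ N ∧
      -- the strategy induced on `R^sym` exists, is unique, and is confluent
      (∀ μ : GraphRewriting.Composition T.R, ∃ S : GraphRewriting.Strategy F T.R.sym,
        S.IsInduced T μ ∧
        (∀ S' : GraphRewriting.Strategy F T.R.sym, S'.IsInduced T μ → S' = S) ∧
        S.Hτ = N ∧ S.Confluent) ∧
      (∀ S : GraphRewriting.Strategy F T.R.sym, S.Hτ = N ∧ S.Confluent) ∧
      -- the quotients
      ∃ (e₁ : coequalizer T.R.src T.R.tgt ≅ coequalizer T.R.sym.src T.R.sym.tgt)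
        (e₂ : coequalizer T.R.sym.src T.R.sym.tgt ≅ F.min),
        coequalizer.π T.R.src T.R.tgt ≫ e₁.hom = coequalizer.π T.R.sym.src T.R.sym.tgt ∧
        coequalizer.π T.R.sym.src T.R.sym.tgt ≫ e₂.hom = N ∧
        (F.minι ≫ coequalizer.π T.R.sym.src T.R.sym.tgt) ≫ e₂.hom = 𝟙 F.min := by
  obtain ⟨N, hN, hstep⟩ := T.exists_normalForm
  have hR : T.R.src ≫ N = T.R.tgt ≫ N := L.equalizes hstep
  have hsym : T.R.sym.src ≫ N = T.R.sym.tgt ≫ N := GraphRewriting.GraphOver.sym_equalizes hR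
  have hS : ∀ S : GraphRewriting.Strategy F T.R.sym, S.Hτ = N ∧ S.Confluent := fun S => by
    have h := S.Hτ_eq_of_equalizes hN hsym
    refine ⟨h, ?_⟩
    rw [GraphRewriting.Strategy.Confluent, h, hsym]
  -- a map equalizing `R` is determined by its restriction to the normal forms
  have hdet : N ≫ F.minι ≫ coequalizer.π T.R.sym.src T.R.sym.tgt =
      coequalizer.π T.R.sym.src T.R.sym.tgt := by
    refine T.hom_ext_of_step_comp ?_ ?_ ?_
    · rw [← Category.assoc, hstep]
    · exact T.step_comp_of_equalizes (GraphRewriting.GraphOver.sym_equalizes_iff.1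
        (coequalizer.condition T.R.sym.src T.R.sym.tgt))
    · rw [← Category.assoc, hN, Category.id_comp]
  refine ⟨N, ⟨hN, hstep.symm.trans (Category.assoc _ _ _)⟩, fun N' h h' => ?_, hsym,
    fun μ => ?_, hS, T.R.coequalizerSymIso,
    ⟨coequalizer.desc N hsym, F.minι ≫ coequalizer.π T.R.sym.src T.R.sym.tgt, ?_, ?_⟩,
    coequalizer.π_desc _ _, coequalizer.π_desc _ _, ?_⟩
  · exact T.hom_ext_of_step_comp ((Category.assoc _ _ _).trans h'.symm) hstep (h.trans hN.symm)
  · obtain ⟨S, h⟩ := T.exists_isInduced μ hN hstep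
    exact ⟨S, h, fun S' h' => h'.unique h, hS S⟩
  · apply coequalizer.hom_ext
    rw [coequalizer.π_desc_assoc, hdet, Category.comp_id]
  · rw [Category.assoc, coequalizer.π_desc, hN]
  · rw [Category.assoc, coequalizer.π_desc, hN]
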